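/- Let $K$ be an algebraically closed field of characteristic zero. Let $K[[x^{1/\mathbf N}]]=\bigcup_{N\ge 1}K[[x^{1/N}]]$ be the ring of fractional power series in one variable with nonnegative exponents. For $\alpha,\beta\in K[[x^{1/\mathbf N}]]$ the contact $O(\alpha,\beta)$ is the order of $\alpha-\beta$, with $O(\alpha,\alpha)=+\infty$. Let $f\in K[[x]][y]$ be a square-free Weierstrass polynomial (monic, all coefficients other than the leading one are non-units) of degree $n$, and let $\operatorname{Zer} f$ be the set of its roots in $K[[x^{1/\mathbf N}]]$. For a nonempty set $B$ of roots let $h(B)$ be the minimal contact between elements of $B$; it is $+\infty$ if and only if $B$ has exactly one element. The Kuo-Lu tree $T(f)$ is the smallest collection of sets of roots, called bars, that contains $\operatorname{Zer} f$ and that contains with every bar $B$ having at least two elements all its postbars, i.e. the equivalence classes of $B$ under the relation $O(\alpha,\alpha')>h(B)$; we write $B\perp B'$ if $B'$ is a postbar of $B$. A bar $B$ is identified with the pseudo-ball $\alpha+x^{h(B)}K[[x^{1/\mathbf N}]]$, $\alpha\in B$ (with $\{\alpha\}$ if $h(B)=+\infty$), which does not depend on the choice of $\alpha$. Let $1\le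 k\le n$ and let $f^{(k)}=\frac{(n-k)!}{n!}\frac{d^k f}{dy^k}$ be the normalized $k$-th derivative. For $B\in T(f)$ let $m(B)$ be the number of roots of $f$ in the pseudo-ball $B$, $n_k(B)=\max\{m(B)-k,0\}$ and $t_k(B)=n_k(B)-\sum_{B\perp B'}n_k(B')$. Let $T_k(f)$ be the set of bars $B\in T(f)$ with $m(B)\ge k$, and for $B\in T_k(f)$ let $B^\circ$ be the pseudo-ball $B$ minus the union of the pseudo-balls of the postbars of $B$ that belong to $T_k(f)$. If $h(B)$ is finite, let $\lambda_B(x)$ be obtained from any element of the pseudo-ball $B$ by omitting all terms of order $\ge h(B)$. The $B$-characteristic polynomial $F_B\in K[z]\setminus\{0\}$ of $f$ is defined by $f(\lambda_B(x)+z\,x^{h(B)})=F_B(z)\,x^{q}+(\text{terms of higher order in }x)$. A polynomial $F\in K[z]$ is called $k$-regular if its $k$-th derivative is zero, or no root of $F$ of multiplicity $\le k$ is a root of its $k$-th derivative. Let $f=\prod_{i=1}^n(y-\alpha_i)$ and $f^{(k)}=\prod_{j=1}^{n-k}(y-\beta_j)$ be the Newton-Puiseux factorizations, with $\alpha_i,\beta_j\in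 K[[x^{1/\mathbf N}]]$. Then: (i) for every $B\in T_k(f)$ the set $\{j:\beta_j\in B\}$ has $n_k(B)$ elements; (ii) for every $B\in T_k(f)$ the set $\{j:\beta_j\in B^\circ\}$ has $t_k(B)$ elements; (iii) for every $j$ there is a unique $B\in T_k(f)$ such that $\beta_j\in B^\circ$; (iv) for every $B\in T_k(f)$ of finite height: if $F_B$ is $k$-regular, then $O(\alpha_i,\beta_j)=h(B)$ for all $\alpha_i\in B$ and $\beta_j\in B^\circ$; otherwise there exist $\alpha_i\in B$ and $\beta_j\in B^\circ$ with $O(\alpha_i,\beta_j)>h(B)$. -/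

import Mathlib

open Polynomial

noncomputable section

namespace KuoLu

/-- The ring `K[[x^{1/ℕ}]]` of fractional power series in one variable: the series
`∑ c_q x^q` whose exponents are nonnegative rationals with a common denominator `N ≥ 1`. -/
def FracSeries (K : Type*) [Field K] : Subring (HahnSeries ℚ K) where
  carrier := {s | ∃ N : ℕ, 0 < N ∧ ∀ q ∈ s.support, ∃ m : ℕ, q = (m : ℚ) / (N : ℚ)}
  zero_mem' := ⟨1, one_pos, fun q hq => by simp at hq⟩
  one_mem' := ⟨1, one_pos, fun q hq => by
    rw [HahnSeries.support_one] at hq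
    exact ⟨0, by simpa using hq⟩⟩
  neg_mem' := by
    rintro s ⟨N, hN, h⟩
    exact ⟨N, hN, fun q hq => h q (by simpa using hq)⟩
  add_mem' := by
    rintro s t ⟨N, hN, hs⟩ ⟨M, hM, ht⟩
    refine ⟨N * M, Nat.mul_pos hN hM, fun q hq => ?_⟩
    have hN' : (N : ℚ) ≠ 0 := by exact_mod_cast hN.ne'
    have hM' : (M : ℚ) ≠ 0 := by exact_mod_cast hM.ne'
    rcases HahnSeries.support_add_subset s t hq with h | h
    · obtain ⟨m, rfl⟩ := hs q h
      exact ⟨m * M, by push_cast; field_simp⟩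
    · obtain ⟨m, rfl⟩ := ht q h
      exact ⟨m * N, by push_cast; field_simp⟩
  mul_mem' := by
    rintro s t ⟨N, hN, hs⟩ ⟨M, hM, ht⟩
    refine ⟨N * M, Nat.mul_pos hN hM, fun q hq => ?_⟩
    have hN' : (N : ℚ) ≠ 0 := by exact_mod_cast hN.ne'
    have hM' : (M : ℚ) ≠ 0 := by exact_mod_cast hM.ne'
    obtain ⟨a, ha, b, hb, rfl⟩ := Set.mem_add.1 (HahnSeries.support_mul_subset hq)
    obtain ⟨m, rfl⟩ := hs a ha
    obtain ⟨l, rfl⟩ := ht b hb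
    exact ⟨m * M + l * N, by push_cast; field_simp⟩

variable {K : Type*} [Field K]

theorem ofPowerSeries_mem (p : PowerSeries K) :
    HahnSeries.ofPowerSeries ℚ K p ∈ FracSeries K := by
  refine ⟨1, one_pos, fun q hq => ?_⟩
  rw [HahnSeries.ofPowerSeries_apply] at hq
  obtain ⟨m, -, rfl⟩ := HahnSeries.support_embDomain_subset hq
  exact ⟨m, by simp⟩

/-- The inclusion `K[[x]] ⊆ K[[x^{1/ℕ}]]`. -/
def incl (K : Type*) [Field K] : PowerSeries K →+* FracSeries K :=
  (HahnSeries.ofPowerSeries ℚ K).codRestrict (FracSeries K) ofPowerSeries_mem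

/-- A Weierstrass polynomial: monic, all coefficients but the leading one are non-units. -/
def IsWeierstrass (f : (PowerSeries K)[X]) : Prop :=
  f.Monic ∧ ∀ i < f.natDegree, ¬ IsUnit (f.coeff i)

/-- The normalized derivative `f^{(k)} = ((n-k)!/n!) d^k f / dy^k`, where `n = deg f`. -/
def normDeriv (k : ℕ) (f : (PowerSeries K)[X]) : (PowerSeries K)[X] :=
  (((f.natDegree - k).factorial : K) / (f.natDegree.factorial : K)) • derivative^[k] f

/-- The contact `O(α, β)`, i.e. the order of `α - β`; it is `⊤` exactly when `α = β`. -/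
def contact (a b : FracSeries K) : WithTop ℚ :=
  ((a : HahnSeries ℚ K) - (b : HahnSeries ℚ K)).orderTop

open Classical in
/-- The set `Zer f` of the roots of `f` in `K[[x^{1/ℕ}]]`. -/
def zer (f : (PowerSeries K)[X]) : Finset (FracSeries K) :=
  (f.map (incl K)).roots.toFinset

/-- The height `h(B)` of a finite set `B` of series: the minimal contact between its elements.
For a one-element set it is `⊤`. -/
def height (B : Finset (FracSeries K)) : WithTop ℚ :=
  (B ×ˢ B).inf fun p => contact p.1 p.2

open Classical in
/-- The postbars of `B`: if `B` has at least two elements, the classes of `B` under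
`a ≡ b mod h(B)⁺`, that is `O(a, b) > h(B)`; a one-element set has none. -/
def postbars (B : Finset (FracSeries K)) : Finset (Finset (FracSeries K)) :=
  if 2 ≤ B.card then B.image fun a => B.filter fun b => height B < contact a b else ∅

/-- The bars of the Kuo-Lu tree `T(f)`, including the leaves (bars of infinite height). -/
inductive IsBar (f : (PowerSeries K)[X]) : Finset (FracSeries K) → Prop
  | root : IsBar f (zer f)
  | post {B B' : Finset (FracSeries K)} : IsBar f B → B' ∈ postbars B → IsBar f B'

/-- The pseudo-ball `a + x^h K[[x^{1/ℕ}]]` of centre `a` and height `h`; it is `{a}` for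
`h = ⊤`. -/
def pseudoBallAt (a : FracSeries K) : WithTop ℚ → Set (FracSeries K)
  | ⊤ => {a}
  | (h : ℚ) => {c | ∃ w : FracSeries K,
      (c : HahnSeries ℚ K) = (a : HahnSeries ℚ K) + HahnSeries.single h 1 * (w : HahnSeries ℚ K)}

/-- The pseudo-ball identified with the bar `B`: the pseudo-ball of height `h(B)` centred at any
element of `B`. -/
def ball (B : Finset (FracSeries K)) : Set (FracSeries K) :=
  {c | ∃ a ∈ B, c ∈ pseudoBallAt a (height B)}

open Classical in
/-- `m(B)`: the number of roots of `f` that belong to (the pseudo-ball of) `B`. -/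
def m (f : (PowerSeries K)[X]) (B : Finset (FracSeries K)) : ℕ :=
  ((zer f).filter fun a => a ∈ ball B).card

/-- `n_k(B) = max {m(B) - k, 0}` (truncated subtraction). -/
def n (f : (PowerSeries K)[X]) (k : ℕ) (B : Finset (FracSeries K)) : ℕ := m f B - k

/-- `t_k(B) = n_k(B) - ∑ n_k(B')`, the sum over all postbars `B'` of `B`. -/
def t (f : (PowerSeries K)[X]) (k : ℕ) (B : Finset (FracSeries K)) : ℤ :=
  (n f k B : ℤ) - ∑ B' ∈ postbars B, (n f k B' : ℤ)

/-- The bars of the subtree `T_k(f)`: the bars `B` of `T(f)` with `m(B) ≥ k`. -/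
def IsBarK (f : (PowerSeries K)[X]) (k : ℕ) (B : Finset (FracSeries K)) : Prop :=
  IsBar f B ∧ k ≤ m f B

/-- `B°`: the pseudo-ball of `B` minus those of the postbars of `B` that belong to `T_k(f)`. -/
def openPart (f : (PowerSeries K)[X]) (k : ℕ) (B : Finset (FracSeries K)) :
    Set (FracSeries K) :=
  ball B \ ⋃ B' ∈ {B' | B' ∈ postbars B ∧ IsBarK f k B'}, ball B'

/-- For a series `c`, an exponent `h` and `λ` the sum of the terms of `c` of order `< h`, the
series `f(λ + z x^h)` in fractional powers of `x` with coefficients in `K[z]`. -/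
def substSeries (f : (PowerSeries K)[X]) (c : FracSeries K) (h : ℚ) : HahnSeries ℚ K[X] :=
  f.eval₂ ((HahnSeries.ofPowerSeries ℚ K[X]).comp (PowerSeries.map (Polynomial.C : K →+* K[X])))
    ((HahnSeries.truncLT h (c : HahnSeries ℚ K)).map (Polynomial.C : K →+* K[X])
      + HahnSeries.single h (Polynomial.X : K[X]))

/-- The characteristic polynomial of `f` with respect to the pseudo-ball `c + x^h K[[x^{1/ℕ}]]`:
the `F ∈ K[z]` with `f(λ + z x^h) = F(z) x^q + (terms of higher order)`, `F ≠ 0`. It depends only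
on the pseudo-ball. -/
def charPoly (f : (PowerSeries K)[X]) (c : FracSeries K) (h : ℚ) : K[X] :=
  (substSeries f c h).leadingCoeff

/-- `F` is `k`-regular: `F^{(k)}` is zero, or no root of `F` of multiplicity `≤ k` is a root of
`F^{(k)}`. -/
def IsRegular (k : ℕ) (F : K[X]) : Prop :=
  derivative^[k] F = 0 ∨
    ∀ z : K, F.IsRoot z → F.rootMultiplicity z ≤ k → ¬ (derivative^[k] F).IsRoot z

end KuoLu

end

/-!
Let `λ` be the sum of the terms of `c` of order `< h`, and write `a_h` for the coefficient of `x^h`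
in `a`. For `g = ∏ (y - aᵢ)` the series `g(λ + z x^h)` is the product of the `λ - aᵢ + z x^h`. The
factors with `O(aᵢ, c) < h` have a constant leading coefficient, the others have leading
coefficient `z - (aᵢ)_h`. So the characteristic polynomial of `g` has degree
`#{i | O(aᵢ, c) ≥ h}`, and the multiplicity of its root `b_h` is `#{i | O(aᵢ, b) > h}` if
`O(b, c) ≥ h`.

Since `∂/∂z (f(λ + z x^h)) = x^h f'(λ + z x^h)`, the characteristic polynomial of `f^{(k)}` is, up
to a nonzero constant, the `k`-th derivative of that of `f`, unless this derivative vanishes.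
Comparing degrees and root multiplicities, a pseudo-ball that contains `m ≥ k` roots of `f`
contains `m - k` roots of `f^{(k)}`, whether it is defined by `O ≥ h` or by `O > h`. Likewise
`O(αᵢ, βⱼ) > h(B)` holds for some `j` if and only if `(αᵢ)_{h(B)}` is a root of `F_B^{(k)}`. Such a
`βⱼ` lies in the postbar `P` of `B` containing `αᵢ` if the multiplicity `m(P)` of this root of `F_B`
exceeds `k`, and in no postbar belonging to `T_k(f)` if `m(P) ≤ k`.
-/

namespace KuoLu

section Polynomials

variable {R ι : Type*} [CommRing R] [IsDomain R]

theorem rootMultiplicity_C_mul {u : R} (hu : u ≠ 0) (p : R[X]) (z : R) :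
    (C u * p).rootMultiplicity z = p.rootMultiplicity z := by
  classical
  rw [← count_roots, ← count_roots, roots_C_mul _ hu]

theorem rootMultiplicity_prod_X_sub_C (s : Finset ι) (a : ι → R) (z : R) :
    (∏ i ∈ s, (X - C (a i))).rootMultiplicity z = {i | i ∈ s ∧ a i = z}.ncard := by
  classical
  have hroots : (∏ i ∈ s, (X - C (a i))).roots = s.val.map a := by
    rw [← roots_multiset_prod_X_sub_C (s.val.map a), Multiset.map_map]
    rfl
  rw [← count_roots, hroots, Multiset.count_map, ← Finset.coe_filter, Set.ncard_coe_finset]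
  simp only [eq_comm (a := z)]
  rfl

variable [CharZero R]

theorem natDegree_iterate_derivative_eq (p : R[X]) (k : ℕ) :
    (derivative^[k] p).natDegree = p.natDegree - k := by
  induction k with
  | zero => rfl
  | succ k ih => rw [Function.iterate_succ_apply', natDegree_derivative, ih, Nat.sub_sub]

theorem iterate_derivative_ne_zero {p : R[X]} (hp : p ≠ 0) {k : ℕ} (hk : k ≤ p.natDegree) :
    derivative^[k] p ≠ 0 := by
  cases k with
  | zero => exact hp
  | succ k =>
    rw [Function.iterate_succ_apply', derivative_ne_zero, natDegree_iterate_derivative_eq]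
    exact Nat.sub_ne_zero_of_lt hk

theorem rootMultiplicity_iterate_derivative (p : R[X]) (z : R) {k : ℕ}
    (hk : k ≤ p.rootMultiplicity z) :
    (derivative^[k] p).rootMultiplicity z = p.rootMultiplicity z - k := by
  induction k with
  | zero => rfl
  | succ k ih =>
    have hmult := ih (Nat.le_of_succ_le hk)
    have hroot : (derivative^[k] p).IsRoot z := by
      by_contra hroot
      rw [rootMultiplicity_eq_zero hroot] at hmult
      omega
    rw [Function.iterate_succ_apply', derivative_rootMultiplicity_of_root hroot, hmult,
      Nat.sub_sub]

end Polynomials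

section SimpleRoots

variable {R S ι : Type*} [CommRing R] [IsDomain R] [IsIntegrallyClosed R] [CharZero R]
  [CommRing S] [IsDomain S] [Algebra R S] [FaithfulSMul R S] {p : R[X]}

theorem aeval_derivative_ne_zero_of_squarefree (hp : p.Monic) (hsq : Squarefree p) {a : S}
    (ha : aeval a p = 0) : aeval a (derivative p) ≠ 0 := by
  intro hda
  have hint : IsIntegral R a := ⟨p, hp, by rwa [← aeval_def]⟩
  obtain ⟨q, hq⟩ := minpoly.isIntegrallyClosed_dvd hint ha
  have hpos : 0 < (minpoly R a).natDegree := minpoly.natDegree_pos hint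
  have hmul : aeval a (derivative (minpoly R a)) * aeval a q = 0 := by
    rwa [hq, derivative_mul, map_add, map_mul, map_mul, minpoly.aeval, zero_mul, add_zero] at hda
  rcases mul_eq_zero.1 hmul with hmin | hqa
  · have hne : derivative (minpoly R a) ≠ 0 := fun h0 => hpos.ne' (derivative_eq_zero.1 h0)
    exact (degree_derivative_lt (minpoly.ne_zero hint)).not_ge
      (minpoly.IsIntegrallyClosed.degree_le_of_ne_zero hne hmin)
  · obtain ⟨r, hr⟩ := minpoly.isIntegrallyClosed_dvd hint hqa
    have hunit : IsUnit (minpoly R a) := hsq _ ⟨r, by rw [mul_assoc, ← hr, ← hq]⟩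
    exact hpos.ne' (natDegree_eq_zero_of_isUnit hunit)

theorem injective_of_map_eq_prod_X_sub_C [Fintype ι] (hsq : Squarefree p) {a : ι → S}
    (hp : p.map (algebraMap R S) = ∏ i, (X - C (a i))) : Function.Injective a := by
  intro i i' hii'
  by_contra hne
  have hmonic : p.Monic :=
    monic_of_injective (FaithfulSMul.algebraMap_injective R S) (hp ▸ monic_prod_X_sub_C _ _)
  have hmult : 1 < (p.map (algebraMap R S)).rootMultiplicity (a i) := by
    rw [hp, rootMultiplicity_prod_X_sub_C, Set.one_lt_ncard]
    exact ⟨i, by simp, i', by simp [hii'], hne⟩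
  have hroot := (one_lt_rootMultiplicity_iff_isRoot (hmonic.map _).ne_zero).1 hmult
  rw [derivative_map, IsRoot, IsRoot, eval_map_algebraMap, eval_map_algebraMap] at hroot
  exact aeval_derivative_ne_zero_of_squarefree hmonic hsq hroot.1 hroot.2

end SimpleRoots

section HahnSeries

variable {Γ R S : Type*}

section Order

variable [LinearOrder Γ]

theorem leadingCoeff_eq_coeff [Zero R] {s : HahnSeries Γ R} {g : Γ} (hg : s.coeff g ≠ 0)
    (hlt : ∀ i < g, s.coeff i = 0) : s.leadingCoeff = s.coeff g := by
  have horder : s.orderTop = g :=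
    le_antisymm (HahnSeries.orderTop_le_of_coeff_ne_zero hg)
      (HahnSeries.le_orderTop_iff_forall.2 fun j hj => hlt j (WithTop.coe_lt_coe.1 hj))
  rw [← HahnSeries.coeff_untop_eq_leadingCoeff (horder ▸ WithTop.coe_ne_top)]
  congr 1
  exact (WithTop.untop_eq_iff _).2 horder

theorem orderTop_map_of_injective [Zero R] [Zero S] {F : Type*} [FunLike F R S]
    [ZeroHomClass F R S] (s : HahnSeries Γ R) {φ : F} (hφ : Function.Injective φ) :
    (s.map φ).orderTop = s.orderTop := by
  refine eq_of_forall_le_iff fun g => ?_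
  simp only [HahnSeries.le_orderTop_iff_forall, HahnSeries.map_coeff, map_eq_zero_iff φ hφ]

theorem leadingCoeff_map_of_injective [Zero R] [Zero S] {F : Type*} [FunLike F R S]
    [ZeroHomClass F R S] (s : HahnSeries Γ R) {φ : F} (hφ : Function.Injective φ) :
    (s.map φ).leadingCoeff = φ s.leadingCoeff := by
  simp only [HahnSeries.leadingCoeff, orderTop_map_of_injective s hφ]
  cases s.orderTop <;> simp

theorem leadingCoeff_add_single_of_le [AddMonoid R] {s : HahnSeries Γ R} {g : Γ} {r : R}
    (hs : (g : WithTop Γ) ≤ s.orderTop) (hr : s.coeff g + r ≠ 0) :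
    (s + HahnSeries.single g r).leadingCoeff = s.coeff g + r := by
  have hcoeff : (s + HahnSeries.single g r).coeff g = s.coeff g + r := by simp
  rw [← hcoeff] at hr ⊢
  refine leadingCoeff_eq_coeff hr fun i hi => ?_
  rw [HahnSeries.coeff_add, HahnSeries.coeff_single_of_ne hi.ne, add_zero]
  exact HahnSeries.coeff_eq_zero_of_lt_orderTop ((WithTop.coe_lt_coe.2 hi).trans_le hs)

theorem lt_orderTop_iff_coeff_eq_zero [Zero R] {s : HahnSeries Γ R} {g : Γ}
    (hs : (g : WithTop Γ) ≤ s.orderTop) : (g : WithTop Γ) < s.orderTop ↔ s.coeff g = 0 :=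
  ⟨HahnSeries.coeff_eq_zero_of_lt_orderTop,
    fun h0 => hs.lt_of_ne (HahnSeries.orderTop_ne_of_coeff_eq_zero h0).symm⟩

theorem leadingCoeff_prod {ι : Type*} [AddCommMonoid Γ] [IsOrderedCancelAddMonoid Γ]
    [CommSemiring R] [NoZeroDivisors R] (t : Finset ι) (s : ι → HahnSeries Γ R) :
    (∏ i ∈ t, s i).leadingCoeff = ∏ i ∈ t, (s i).leadingCoeff := by
  classical
  induction t using Finset.induction_on with
  | empty => simp
  | insert i t hi ih =>
    rw [Finset.prod_insert hi, Finset.prod_insert hi, HahnSeries.leadingCoeff_mul, ih]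

end Order

section Map

/-- The ring homomorphism between rings of Hahn series that applies `φ` to every coefficient. -/
def mapRingHom [PartialOrder Γ] [AddCommMonoid Γ] [IsOrderedCancelAddMonoid Γ] [Semiring R]
    [Semiring S] (φ : R →+* S) : HahnSeries Γ R →+* HahnSeries Γ S where
  toFun s := s.map φ
  map_zero' := HahnSeries.map_zero (φ : ZeroHom R S)
  map_one' := HahnSeries.map_one φ.toMonoidWithZeroHom
  map_add' _ _ := HahnSeries.map_add φ.toAddMonoidHom
  map_mul' _ _ := HahnSeries.map_mul φ.toNonUnitalRingHom

@[simp]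
theorem coeff_mapRingHom [PartialOrder Γ] [AddCommMonoid Γ] [IsOrderedCancelAddMonoid Γ]
    [Semiring R] [Semiring S] (φ : R →+* S) (s : HahnSeries Γ R) (g : Γ) :
    (mapRingHom φ s).coeff g = φ (s.coeff g) := rfl

theorem mapRingHom_ofPowerSeries [Semiring Γ] [PartialOrder Γ] [IsStrictOrderedRing Γ] [Semiring R]
    [Semiring S] (φ : R →+* S) (p : PowerSeries R) :
    mapRingHom φ (HahnSeries.ofPowerSeries Γ R p) =
      HahnSeries.ofPowerSeries Γ S (PowerSeries.map φ p) := by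
  ext1; funext g
  rw [coeff_mapRingHom]
  by_cases hg : g ∈ Set.range ((↑) : ℕ → Γ)
  · obtain ⟨i, rfl⟩ := hg
    simp only [HahnSeries.ofPowerSeries_apply_coeff, PowerSeries.coeff_map]
  · rw [HahnSeries.ofPowerSeries_apply, HahnSeries.ofPowerSeries_apply,
      HahnSeries.embDomain_of_notMem_range hg, HahnSeries.embDomain_of_notMem_range hg, map_zero]

end Map

section CoeffDeriv

variable [CommRing R]

/-- The coefficientwise derivative of a Hahn series with polynomial coefficients: the derivation
`∂/∂z` of the ring of series in `x` over `R[z]`. -/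
noncomputable def coeffDeriv [PartialOrder Γ] (s : HahnSeries Γ R[X]) : HahnSeries Γ R[X] :=
  s.map (derivative : R[X] →ₗ[R] R[X])

@[simp]
theorem coeff_coeffDeriv [PartialOrder Γ] (s : HahnSeries Γ R[X]) (g : Γ) :
    (coeffDeriv s).coeff g = derivative (s.coeff g) := rfl

theorem coeffDeriv_add [PartialOrder Γ] (s t : HahnSeries Γ R[X]) :
    coeffDeriv (s + t) = coeffDeriv s + coeffDeriv t := by
  ext1; funext g; simp

theorem coeffDeriv_mul [PartialOrder Γ] [AddCommMonoid Γ] [IsOrderedCancelAddMonoid Γ]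
    (s t : HahnSeries Γ R[X]) : coeffDeriv (s * t) = coeffDeriv s * t + s * coeffDeriv t := by
  have hsupp (r : HahnSeries Γ R[X]) : (coeffDeriv r).support ⊆ r.support :=
    fun g hg h0 => hg (by simp [h0])
  ext1; funext g
  rw [coeff_coeffDeriv, HahnSeries.coeff_add, HahnSeries.coeff_mul,
    HahnSeries.coeff_mul_left' s.isPWO_support (hsupp s),
    HahnSeries.coeff_mul_right' t.isPWO_support (hsupp t), ← Finset.sum_add_distrib,
    derivative_sum]
  exact Finset.sum_congr rfl fun p _ => derivative_mul

theorem coeffDeriv_eval₂ [PartialOrder Γ] [AddCommMonoid Γ] [IsOrderedCancelAddMonoid Γ]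
    {A : Type*} [CommRing A] (φ : A →+* HahnSeries Γ R[X]) (hφ : ∀ a, coeffDeriv (φ a) = 0)
    (s : HahnSeries Γ R[X]) (p : A[X]) :
    coeffDeriv (p.eval₂ φ s) = coeffDeriv s * (derivative p).eval₂ φ s := by
  induction p using Polynomial.induction_on with
  | C a => simp [hφ]
  | add p q hp hq => simp [eval₂_add, coeffDeriv_add, hp, hq, mul_add]
  | monomial i a ih =>
    rw [pow_succ, ← mul_assoc, eval₂_mul, coeffDeriv_mul, ih, eval₂_X, derivative_mul (g := X),
      derivative_X, mul_one, eval₂_add, eval₂_mul (p := derivative _), eval₂_X]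
    ring

theorem leadingCoeff_coeffDeriv [LinearOrder Γ] {s : HahnSeries Γ R[X]}
    (hs : derivative s.leadingCoeff ≠ 0) :
    (coeffDeriv s).leadingCoeff = derivative s.leadingCoeff := by
  have hs0 : s ≠ 0 := by rintro rfl; simp at hs
  rw [HahnSeries.leadingCoeff_of_ne_zero hs0, ← coeff_coeffDeriv] at hs ⊢
  refine leadingCoeff_eq_coeff hs fun i hi => ?_
  have hi' : (i : WithTop Γ) < s.orderTop :=
    (WithTop.coe_lt_coe.2 hi).trans_eq (WithTop.coe_untop _ _)
  rw [coeff_coeffDeriv, HahnSeries.coeff_eq_zero_of_lt_orderTop hi', map_zero]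

end CoeffDeriv

end HahnSeries

section FracSeries

variable {K : Type*} [Field K]

theorem mem_fracSeries_iff {s : HahnSeries ℚ K} : s ∈ FracSeries K ↔
    0 ≤ s.orderTop ∧ ∃ N : ℕ, 0 < N ∧ ∀ q ∈ s.support, ∃ z : ℤ, q = z / N := by
  constructor
  · rintro ⟨N, hN, hs⟩
    refine ⟨HahnSeries.le_orderTop_iff_forall.2 fun q hq => ?_, N, hN, fun q hq => ?_⟩
    · by_contra hq'
      obtain ⟨z, rfl⟩ := hs q hq'
      exact (WithTop.coe_lt_coe.1 hq).not_ge (by positivity)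
    · obtain ⟨z, rfl⟩ := hs q hq
      exact ⟨z, by simp⟩
  · rintro ⟨hs0, N, hN, hs⟩
    refine ⟨N, hN, fun q hq => ?_⟩
    obtain ⟨z, rfl⟩ := hs q hq
    have hz : (0 : ℚ) ≤ z / N :=
      WithTop.coe_le_coe.1 (hs0.trans (HahnSeries.orderTop_le_of_coeff_ne_zero hq))
    have hz0 : 0 ≤ z := by
      rw [le_div_iff₀ (by positivity), zero_mul] at hz
      exact_mod_cast hz
    exact ⟨z.toNat, by rw [← Int.cast_natCast z.toNat, Int.toNat_of_nonneg hz0]⟩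

theorem single_mul_mem_fracSeries {s : HahnSeries ℚ K} (hs : s ∈ FracSeries K) {g : ℚ}
    (hg : 0 ≤ (g : WithTop ℚ) + s.orderTop) : HahnSeries.single g 1 * s ∈ FracSeries K := by
  obtain ⟨-, N, hN, hs⟩ := mem_fracSeries_iff.1 hs
  rw [mem_fracSeries_iff, HahnSeries.orderTop_mul, HahnSeries.orderTop_single one_ne_zero]
  refine ⟨hg, N * g.den, Nat.mul_pos hN g.den_pos, fun q hq => ?_⟩
  rw [HahnSeries.mem_support, HahnSeries.coeff_single_mul, one_mul] at hq
  obtain ⟨z, hz⟩ := hs (q - g) hq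
  refine ⟨z * g.den + g.num * N, ?_⟩
  rw [eq_add_of_sub_eq hz]
  nth_rw 1 [← Rat.num_div_den g]
  push_cast
  field_simp

theorem incl_injective : Function.Injective (incl K) := fun _ _ hpq =>
  HahnSeries.ofPowerSeries_injective (Subtype.ext_iff.1 hpq)

instance [CharZero K] : CharZero (FracSeries K) :=
  charZero_of_injective_ringHom (f := (incl K).comp PowerSeries.C)
    (incl_injective.comp PowerSeries.C_injective)

theorem injective_of_map_incl_eq_prod [CharZero K] {ι : Type*} [Fintype ι] {f : (PowerSeries K)[X]}
    (hsq : Squarefree f) {α : ι → FracSeries K} (hα : f.map (incl K) = ∏ i, (X - C (α i))) :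
    Function.Injective α := by
  let _ : Algebra (PowerSeries K) (FracSeries K) := (incl K).toAlgebra
  have : FaithfulSMul (PowerSeries K) (FracSeries K) :=
    (faithfulSMul_iff_algebraMap_injective _ _).2 incl_injective
  have : CharZero (PowerSeries K) := charZero_of_injective_ringHom PowerSeries.C_injective
  exact injective_of_map_eq_prod_X_sub_C hsq hα

theorem exists_normDeriv_eq_C_mul [CharZero K] (k : ℕ) (f : (PowerSeries K)[X]) :
    ∃ r : K, r ≠ 0 ∧ normDeriv k f = C (PowerSeries.C r) * derivative^[k] f := by
  refine ⟨_, div_ne_zero (Nat.cast_ne_zero.2 (f.natDegree - k).factorial_ne_zero)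
    (Nat.cast_ne_zero.2 f.natDegree.factorial_ne_zero), ?_⟩
  ext1 i
  rw [normDeriv, coeff_smul, coeff_C_mul, PowerSeries.smul_eq_C_mul]

theorem natDegree_normDeriv [CharZero K] (k : ℕ) (f : (PowerSeries K)[X]) :
    (normDeriv k f).natDegree = f.natDegree - k := by
  have : CharZero (PowerSeries K) := charZero_of_injective_ringHom PowerSeries.C_injective
  obtain ⟨r, hr, hfk⟩ := exists_normDeriv_eq_C_mul k f
  have hr' : PowerSeries.C r ≠ 0 := (map_ne_zero_iff _ PowerSeries.C_injective).2 hr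
  rw [hfk, natDegree_C_mul hr', natDegree_iterate_derivative_eq]

theorem natDegree_of_map_incl_eq_prod {ι : Type*} [Fintype ι] {g : (PowerSeries K)[X]}
    {a : ι → FracSeries K} (hg : g.map (incl K) = ∏ i, (X - C (a i))) :
    g.natDegree = Fintype.card ι := by
  rw [← natDegree_map_eq_of_injective incl_injective, hg, natDegree_finsetProd_X_sub_C_eq_card,
    Finset.card_univ]

section Contact

variable {a b c : FracSeries K} {h : WithTop ℚ}

theorem contact_comm (a b : FracSeries K) : contact a b = contact b a := by
  rw [contact, contact, ← HahnSeries.orderTop_neg, neg_sub]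

@[simp]
theorem contact_self (a : FracSeries K) : contact a a = ⊤ := by
  rw [contact, sub_self, HahnSeries.orderTop_zero]

theorem contact_eq_top : contact a b = ⊤ ↔ a = b := by
  rw [contact, HahnSeries.orderTop_eq_top, sub_eq_zero, Subtype.coe_inj]

theorem min_contact_le (a b c : FracSeries K) :
    min (contact a b) (contact b c) ≤ contact a c := by
  rw [contact, contact, contact, ← sub_add_sub_cancel (a : HahnSeries ℚ K) b c]
  exact HahnSeries.min_orderTop_le_orderTop_add

theorem le_contact_trans (hab : h ≤ contact a b) (hbc : h ≤ contact b c) : h ≤ contact a c :=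
  (le_min hab hbc).trans (min_contact_le a b c)

theorem lt_contact_trans (hab : h < contact a b) (hbc : h < contact b c) : h < contact a c :=
  (lt_min hab hbc).trans_le (min_contact_le a b c)

theorem lt_contact_iff_coeff_eq {q : ℚ} (hab : (q : WithTop ℚ) ≤ contact a b) :
    (q : WithTop ℚ) < contact a b ↔
      (a : HahnSeries ℚ K).coeff q = (b : HahnSeries ℚ K).coeff q := by
  rw [contact, lt_orderTop_iff_coeff_eq_zero hab, HahnSeries.coeff_sub, sub_eq_zero]

theorem mem_pseudoBallAt : c ∈ pseudoBallAt a h ↔ h ≤ contact c a := by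
  cases h with
  | top => exact contact_eq_top.symm.trans top_le_iff.symm
  | coe h =>
    rw [contact]
    constructor
    · rintro ⟨w, hw⟩
      rw [hw, add_sub_cancel_left, HahnSeries.orderTop_mul,
        HahnSeries.orderTop_single one_ne_zero]
      exact le_add_of_nonneg_right (mem_fracSeries_iff.1 w.2).1
    · intro hle
      have hshift : 0 ≤ ((-h : ℚ) : WithTop ℚ) + ((c : HahnSeries ℚ K) - a).orderTop := by
        simpa [← WithTop.coe_add] using add_le_add_right hle ((-h : ℚ) : WithTop ℚ)
      refine ⟨⟨_, single_mul_mem_fracSeries (sub_mem c.2 a.2) hshift⟩, ?_⟩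
      rw [← mul_assoc, HahnSeries.single_mul_single, add_neg_cancel, mul_one,
        HahnSeries.single_zero_one, one_mul, add_sub_cancel]

end Contact

end FracSeries

section CharPoly

variable {K : Type*} [Field K]

section LinearFactor

/-- The factor `λ - a + z x^h` of `substSeries g c h` that belongs to a root `a` of `g`; here `λ` is
the sum of the terms of `c` of order `< h`. -/
noncomputable def linearFactor (a c : FracSeries K) (h : ℚ) : HahnSeries ℚ K[X] :=
  mapRingHom C (HahnSeries.truncLT h (c : HahnSeries ℚ K) - (a : HahnSeries ℚ K)) +
    HahnSeries.single h X

variable {a c : FracSeries K} {h : ℚ}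

theorem le_orderTop_truncLT_sub_iff : (h : WithTop ℚ) ≤
      (HahnSeries.truncLT h (c : HahnSeries ℚ K) - (a : HahnSeries ℚ K)).orderTop ↔
    (h : WithTop ℚ) ≤ contact a c := by
  rw [contact_comm, contact, HahnSeries.le_orderTop_iff_forall, HahnSeries.le_orderTop_iff_forall]
  refine forall₂_congr fun q hq => ?_
  rw [HahnSeries.coeff_sub, HahnSeries.coeff_sub,
    HahnSeries.coeff_truncLT_of_lt (WithTop.coe_lt_coe.1 hq)]

theorem leadingCoeff_linearFactor_of_le_contact (hac : (h : WithTop ℚ) ≤ contact a c) :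
    (linearFactor a c h).leadingCoeff = X - C ((a : HahnSeries ℚ K).coeff h) := by
  set s := HahnSeries.truncLT h (c : HahnSeries ℚ K) - (a : HahnSeries ℚ K) with hs
  have hcoeff : (mapRingHom C s).coeff h + X = X - C ((a : HahnSeries ℚ K).coeff h) := by
    simp [hs, add_comm, sub_eq_add_neg]
  rw [linearFactor, leadingCoeff_add_single_of_le, hcoeff]
  · exact (le_orderTop_truncLT_sub_iff.2 hac).trans_eq
      (orderTop_map_of_injective s (C_injective (R := K))).symm
  · rw [hcoeff]
    exact X_sub_C_ne_zero _

theorem leadingCoeff_linearFactor_of_contact_lt (hac : contact a c < h) :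
    ∃ u : K, u ≠ 0 ∧ (linearFactor a c h).leadingCoeff = C u := by
  set s := HahnSeries.truncLT h (c : HahnSeries ℚ K) - (a : HahnSeries ℚ K)
  have hlt : s.orderTop < h :=
    lt_of_not_ge fun hle => hac.not_ge (le_orderTop_truncLT_sub_iff.1 hle)
  refine ⟨s.leadingCoeff, HahnSeries.leadingCoeff_ne_zero.2 fun h0 => ?_, ?_⟩
  · rw [h0, HahnSeries.orderTop_zero] at hlt
    exact not_top_lt hlt
  · rw [linearFactor, HahnSeries.leadingCoeff_add_eq_left]
    · exact leadingCoeff_map_of_injective s C_injective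
    · rw [HahnSeries.orderTop_single X_ne_zero]
      exact (orderTop_map_of_injective s C_injective).trans_lt hlt

end LinearFactor

section Product

variable {ι : Type*} [Fintype ι] {g : (PowerSeries K)[X]} {a : ι → FracSeries K}

theorem substSeries_eq_prod (hg : g.map (incl K) = ∏ i, (X - C (a i))) (c : FracSeries K) (h : ℚ) :
    substSeries g c h = ∏ i, linearFactor (a i) c h := by
  have hcomp : (HahnSeries.ofPowerSeries ℚ K[X]).comp (PowerSeries.map (C : K →+* K[X])) =
      ((mapRingHom C).comp (FracSeries K).subtype).comp (incl K) :=
    RingHom.ext fun p => (mapRingHom_ofPowerSeries C p).symm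
  rw [substSeries, hcomp, ← eval₂_map, hg, eval₂_finsetProd]
  refine Finset.prod_congr rfl fun i _ => ?_
  rw [eval₂_sub, eval₂_X, eval₂_C, linearFactor, map_sub, sub_add_eq_add_sub]
  rfl

open Classical in
theorem exists_charPoly_eq_C_mul_prod (hg : g.map (incl K) = ∏ i, (X - C (a i)))
    (c : FracSeries K) (h : ℚ) :
    ∃ u : K, u ≠ 0 ∧ charPoly g c h =
      C u * ∏ i with (h : WithTop ℚ) ≤ contact (a i) c,
        (X - C ((a i : HahnSeries ℚ K).coeff h)) := by
  have hfar : ∃ u : K, u ≠ 0 ∧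
      ∏ i with ¬ (h : WithTop ℚ) ≤ contact (a i) c,
        (linearFactor (a i) c h).leadingCoeff = C u := by
    refine Finset.prod_induction _ (fun F : K[X] => ∃ u : K, u ≠ 0 ∧ F = C u) ?_
      ⟨1, one_ne_zero, C_1.symm⟩ fun i hi => ?_
    · rintro _ _ ⟨u, hu, rfl⟩ ⟨v, hv, rfl⟩
      exact ⟨u * v, mul_ne_zero hu hv, C_mul.symm⟩
    · exact leadingCoeff_linearFactor_of_contact_lt (not_le.1 (Finset.mem_filter.1 hi).2)
  obtain ⟨u, hu, hfar⟩ := hfar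
  refine ⟨u, hu, ?_⟩
  rw [charPoly, substSeries_eq_prod hg, leadingCoeff_prod,
    ← Finset.prod_filter_mul_prod_filter_not _ fun i => (h : WithTop ℚ) ≤ contact (a i) c, hfar,
    mul_comm]
  congr 1
  exact Finset.prod_congr rfl fun i hi =>
    leadingCoeff_linearFactor_of_le_contact (Finset.mem_filter.1 hi).2

theorem charPoly_ne_zero (hg : g.map (incl K) = ∏ i, (X - C (a i))) (c : FracSeries K) (h : ℚ) :
    charPoly g c h ≠ 0 := by
  classical
  obtain ⟨u, hu, hF⟩ := exists_charPoly_eq_C_mul_prod hg c h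
  rw [hF]
  exact mul_ne_zero (C_ne_zero.2 hu) (monic_prod_X_sub_C _ _).ne_zero

theorem natDegree_charPoly (hg : g.map (incl K) = ∏ i, (X - C (a i))) (c : FracSeries K) (h : ℚ) :
    (charPoly g c h).natDegree = {i | (h : WithTop ℚ) ≤ contact (a i) c}.ncard := by
  classical
  obtain ⟨u, hu, hF⟩ := exists_charPoly_eq_C_mul_prod hg c h
  rw [hF, natDegree_C_mul hu, natDegree_finsetProd_X_sub_C_eq_card, ← Set.ncard_coe_finset]
  simp

theorem isRoot_charPoly_iff (hg : g.map (incl K) = ∏ i, (X - C (a i))) {c : FracSeries K} {h : ℚ}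
    {z : K} : (charPoly g c h).IsRoot z ↔
      ∃ i, (h : WithTop ℚ) ≤ contact (a i) c ∧ (a i : HahnSeries ℚ K).coeff h = z := by
  classical
  obtain ⟨u, hu, hF⟩ := exists_charPoly_eq_C_mul_prod hg c h
  simp only [hF, IsRoot, eval_mul, eval_C, mul_eq_zero, hu, false_or, eval_prod,
    Finset.prod_eq_zero_iff, Finset.mem_filter, Finset.mem_univ, true_and, eval_sub, eval_X,
    sub_eq_zero, eq_comm (a := z)]

theorem rootMultiplicity_charPoly (hg : g.map (incl K) = ∏ i, (X - C (a i))) {b c : FracSeries K}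
    {h : ℚ} (hbc : (h : WithTop ℚ) ≤ contact b c) :
    (charPoly g c h).rootMultiplicity ((b : HahnSeries ℚ K).coeff h) =
      {i | (h : WithTop ℚ) < contact (a i) b}.ncard := by
  classical
  obtain ⟨u, hu, hF⟩ := exists_charPoly_eq_C_mul_prod hg c h
  rw [hF, rootMultiplicity_C_mul hu, rootMultiplicity_prod_X_sub_C]
  congr 1
  ext i
  simp only [Finset.mem_filter, Finset.mem_univ, true_and, Set.mem_ofPred_eq]
  constructor
  · rintro ⟨hic, hcoeff⟩
    exact (lt_contact_iff_coeff_eq (le_contact_trans hic (contact_comm b c ▸ hbc))).2 hcoeff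
  · exact fun hib => ⟨le_contact_trans hib.le hbc, (lt_contact_iff_coeff_eq hib.le).1 hib⟩

end Product

section Derivative

variable (f : (PowerSeries K)[X]) (c : FracSeries K) (h : ℚ)

theorem coeffDeriv_substSeries :
    coeffDeriv (substSeries f c h) = HahnSeries.single h 1 * substSeries (derivative f) c h := by
  have hlin : coeffDeriv ((HahnSeries.truncLT h (c : HahnSeries ℚ K)).map (C : K →+* K[X]) +
      HahnSeries.single h (X : K[X])) = HahnSeries.single h 1 := by
    ext1; funext g
    by_cases hg : g = h
    · subst hg; simp
    · simp [HahnSeries.coeff_single_of_ne hg]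
  rw [substSeries, substSeries, coeffDeriv_eval₂, hlin]
  intro p
  rw [RingHom.comp_apply, ← mapRingHom_ofPowerSeries]
  ext1; funext g
  simp

theorem charPoly_derivative (hF : derivative (charPoly f c h) ≠ 0) :
    charPoly (derivative f) c h = derivative (charPoly f c h) := by
  have hlead := leadingCoeff_coeffDeriv hF
  rwa [coeffDeriv_substSeries, HahnSeries.leadingCoeff_mul, HahnSeries.leadingCoeff_of_single,
    one_mul] at hlead

theorem charPoly_iterate_derivative {k : ℕ} (hF : derivative^[k] (charPoly f c h) ≠ 0) :
    charPoly (derivative^[k] f) c h = derivative^[k] (charPoly f c h) := by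
  induction k with
  | zero => rfl
  | succ k ih =>
    rw [Function.iterate_succ_apply'] at hF ⊢
    have hk := ih fun h0 => hF (by rw [h0, map_zero])
    rw [Function.iterate_succ_apply', ← hk]
    exact charPoly_derivative _ c h (hk ▸ hF)

theorem charPoly_C_mul (r : K) :
    charPoly (C (PowerSeries.C r) * f) c h = C r * charPoly f c h := by
  rw [charPoly, substSeries, eval₂_mul, HahnSeries.leadingCoeff_mul, eval₂_C, RingHom.comp_apply,
    PowerSeries.map_C, HahnSeries.ofPowerSeries_C, HahnSeries.C_apply,
    HahnSeries.leadingCoeff_of_single]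
  rfl

theorem exists_charPoly_normDeriv_eq [CharZero K] {k : ℕ}
    (hF : derivative^[k] (charPoly f c h) ≠ 0) :
    ∃ r : K, r ≠ 0 ∧ charPoly (normDeriv k f) c h = C r * derivative^[k] (charPoly f c h) := by
  obtain ⟨r, hr, hk⟩ := exists_normDeriv_eq_C_mul k f
  exact ⟨r, hr, by rw [hk, charPoly_C_mul, charPoly_iterate_derivative f c h hF]⟩

end Derivative

end CharPoly

section Bars

variable {K : Type*} [Field K] {B P Q : Finset (FracSeries K)} {a b c : FracSeries K}

theorem height_le_contact (ha : a ∈ B) (hb : b ∈ B) : height B ≤ contact a b :=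
  Finset.inf_le (f := fun p : FracSeries K × FracSeries K => contact p.1 p.2)
    (Finset.mk_mem_product ha hb)

theorem height_anti (hPB : P ⊆ B) : height B ≤ height P :=
  Finset.inf_mono (Finset.product_subset_product hPB hPB)

theorem exists_contact_eq_height (hB : B.Nonempty) : ∃ a ∈ B, ∃ b ∈ B, contact a b = height B := by
  obtain ⟨⟨a, b⟩, hab, heq⟩ :=
    Finset.exists_mem_eq_inf (B ×ˢ B) (hB.product hB) fun p => contact p.1 p.2
  exact ⟨a, (Finset.mem_product.1 hab).1, b, (Finset.mem_product.1 hab).2, heq.symm⟩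

theorem height_lt_top_iff : height B < ⊤ ↔ 2 ≤ B.card := by
  rw [← not_iff_not, not_lt_top_iff, ← top_le_iff, height, Finset.le_inf_iff, not_le,
    Nat.lt_succ_iff, Finset.card_le_one]
  simp only [Finset.mem_product, Prod.forall, and_imp, top_le_iff, contact_eq_top]
  exact forall_congr' fun _ => ⟨fun h ha b hb => h b ha hb, fun h b ha hb => h ha b hb⟩

theorem mem_ball_iff (ha : a ∈ B) : c ∈ ball B ↔ height B ≤ contact c a := by
  constructor
  · rintro ⟨b, hb, hcb⟩
    exact le_contact_trans (mem_pseudoBallAt.1 hcb) (height_le_contact hb ha)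
  · exact fun hca => ⟨a, ha, mem_pseudoBallAt.2 hca⟩

theorem mem_ball_of_mem (ha : a ∈ B) : a ∈ ball B :=
  (mem_ball_iff ha).2 (height_le_contact ha ha)

theorem ball_mono (hPB : P ⊆ B) : ball P ⊆ ball B := by
  rintro c ⟨a, ha, hca⟩
  exact (mem_ball_iff (hPB ha)).2 ((height_anti hPB).trans (mem_pseudoBallAt.1 hca))

theorem mem_ball_iff_of_mem_ball (hb : b ∈ ball B) : c ∈ ball B ↔ height B ≤ contact c b := by
  obtain ⟨a, ha, hba⟩ := hb
  rw [mem_pseudoBallAt] at hba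
  rw [mem_ball_iff ha]
  exact ⟨fun hca => le_contact_trans hca (contact_comm b a ▸ hba),
    fun hcb => le_contact_trans hcb hba⟩

theorem mem_postbars : P ∈ postbars B ↔
    height B < ⊤ ∧ ∃ a ∈ B, ∀ b, b ∈ P ↔ b ∈ B ∧ height B < contact b a := by
  rw [postbars, height_lt_top_iff]
  split_ifs with hB
  · simp only [Finset.mem_image, Finset.ext_iff, Finset.mem_filter, hB, true_and,
      contact_comm _ (_ : FracSeries K), eq_comm, iff_comm]
  · simp [hB]

theorem mem_postbar_iff (hP : P ∈ postbars B) (ha : a ∈ P) :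
    b ∈ P ↔ b ∈ B ∧ height B < contact b a := by
  obtain ⟨-, c, -, hc⟩ := mem_postbars.1 hP
  have hac := ((hc a).1 ha).2
  rw [hc]
  exact and_congr_right fun _ => ⟨fun hbc => lt_contact_trans hbc (contact_comm a c ▸ hac),
    fun hba => lt_contact_trans hba hac⟩

theorem postbar_subset (hP : P ∈ postbars B) : P ⊆ B := by
  obtain ⟨-, a, -, ha⟩ := mem_postbars.1 hP
  exact fun b hb => ((ha b).1 hb).1

theorem postbar_nonempty (hP : P ∈ postbars B) : P.Nonempty := by
  obtain ⟨hB, a, haB, ha⟩ := mem_postbars.1 hP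
  exact ⟨a, (ha a).2 ⟨haB, by rwa [contact_self]⟩⟩

theorem height_lt_height (hP : P ∈ postbars B) : height B < height P := by
  obtain ⟨a, ha, b, hb, hab⟩ := exists_contact_eq_height (postbar_nonempty hP)
  exact hab ▸ ((mem_postbar_iff hP hb).1 ha).2

theorem card_postbar_lt (hP : P ∈ postbars B) : P.card < B.card :=
  Finset.card_lt_card <| (postbar_subset hP).ssubset_of_ne fun h =>
    (h ▸ height_lt_height hP).false

theorem exists_postbar_superset (hPB : P ⊆ B) (hP : P.Nonempty) (hlt : height B < height P) :
    ∃ Q ∈ postbars B, P ⊆ Q := by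
  classical
  obtain ⟨a, ha⟩ := hP
  refine ⟨B.filter fun b => height B < contact b a, ?_, fun b hb => ?_⟩
  · exact mem_postbars.2 ⟨hlt.trans_le le_top, a, hPB ha, fun b => Finset.mem_filter⟩
  · exact Finset.mem_filter.2 ⟨hPB hb, hlt.trans_le (height_le_contact hb ha)⟩

theorem exists_mem_postbar (hB : height B < ⊤) (ha : a ∈ B) : ∃ P ∈ postbars B, a ∈ P := by
  obtain ⟨P, hP, haP⟩ := exists_postbar_superset (Finset.singleton_subset_iff.2 ha)
    (Finset.singleton_nonempty a) (by simpa [height] using hB)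
  exact ⟨P, hP, Finset.singleton_subset_iff.1 haP⟩

theorem postbar_eq_of_mem_ball (hP : P ∈ postbars B) (hQ : Q ∈ postbars B) (hcP : c ∈ ball P)
    (hcQ : c ∈ ball Q) : P = Q := by
  obtain ⟨a, ha⟩ := postbar_nonempty hP
  obtain ⟨b, hb⟩ := postbar_nonempty hQ
  have hca := (height_lt_height hP).trans_le ((mem_ball_iff ha).1 hcP)
  have hcb := (height_lt_height hQ).trans_le ((mem_ball_iff hb).1 hcQ)
  have hbP : b ∈ P := (mem_postbar_iff hP ha).2
    ⟨postbar_subset hQ hb, lt_contact_trans (contact_comm c b ▸ hcb) hca⟩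
  ext x
  rw [mem_postbar_iff hP hbP, mem_postbar_iff hQ hb]

end Bars

section Tree

variable {K : Type*} [Field K] {f : (PowerSeries K)[X]} {k : ℕ} {B P : Finset (FracSeries K)}
  {a c : FracSeries K}

theorem IsBar.subset_zer (hB : IsBar f B) : B ⊆ zer f := by
  induction hB with
  | root => exact subset_rfl
  | post _ hP ih => exact (postbar_subset hP).trans ih

theorem IsBar.mem_of_mem_ball (hB : IsBar f B) (hc : c ∈ zer f) (hcB : c ∈ ball B) : c ∈ B := by
  induction hB with
  | root => exact hc
  | post _ hP ih =>
    obtain ⟨a, ha⟩ := postbar_nonempty hP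
    exact (mem_postbar_iff hP ha).2 ⟨ih (ball_mono (postbar_subset hP) hcB),
      (height_lt_height hP).trans_le ((mem_ball_iff ha).1 hcB)⟩

theorem IsBar.m_eq_card (hB : IsBar f B) : m f B = B.card := by
  classical
  rw [m]
  congr 1
  ext a
  rw [Finset.mem_filter]
  exact ⟨fun ha => hB.mem_of_mem_ball ha.1 ha.2,
    fun ha => ⟨hB.subset_zer ha, mem_ball_of_mem ha⟩⟩

theorem IsBar.mem_iff_height_le_contact (hB : IsBar f B) (ha : a ∈ B) (hc : c ∈ zer f) :
    c ∈ B ↔ height B ≤ contact c a :=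
  ⟨fun hcB => height_le_contact hcB ha,
    fun hca => hB.mem_of_mem_ball hc ((mem_ball_iff ha).2 hca)⟩

theorem IsBar.mem_postbar_iff_height_lt_contact (hB : IsBar f B) (hP : P ∈ postbars B)
    (ha : a ∈ P) (hc : c ∈ zer f) : c ∈ P ↔ height B < contact c a := by
  rw [mem_postbar_iff hP ha, and_iff_right_iff_imp]
  exact fun hca => (hB.mem_iff_height_le_contact (postbar_subset hP ha) hc).2 hca.le

theorem IsBar.subset_of_height_le (hB : IsBar f B) (hP : IsBar f P) (hcB : c ∈ ball B)
    (hcP : c ∈ ball P) (hle : height B ≤ height P) : P ⊆ B := fun _ ha =>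
  hB.mem_of_mem_ball (hP.subset_zer ha) <| (mem_ball_iff_of_mem_ball hcB).2 <|
    hle.trans ((mem_ball_iff_of_mem_ball hcP).1 (mem_ball_of_mem ha))

theorem IsBar.eq_of_height_eq (hB : IsBar f B) (hP : IsBar f P) (hcB : c ∈ ball B)
    (hcP : c ∈ ball P) (heq : height B = height P) : B = P :=
  (hP.subset_of_height_le hB hcP hcB heq.ge).antisymm (hB.subset_of_height_le hP hcB hcP heq.le)

theorem IsBarK.mono (hP : IsBarK f k P) (hB : IsBar f B) (hPB : P ⊆ B) : IsBarK f k B :=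
  ⟨hB, hP.2.trans (by rw [hB.m_eq_card, hP.1.m_eq_card]; exact Finset.card_le_card hPB)⟩

theorem mem_openPart : c ∈ openPart f k B ↔
    c ∈ ball B ∧ ∀ P ∈ postbars B, IsBarK f k P → c ∉ ball P := by
  simp [openPart]

theorem eq_of_mem_openPart (hB : IsBarK f k B) (hP : IsBarK f k P) (hcB : c ∈ openPart f k B)
    (hcP : c ∈ openPart f k P) : B = P := by
  wlog hle : height B ≤ height P generalizing B P
  · exact (this hP hB hcP hcB (le_of_not_ge hle)).symm
  rw [mem_openPart] at hcB hcP
  rcases hle.eq_or_lt with heq | hlt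
  · exact hB.1.eq_of_height_eq hP.1 hcB.1 hcP.1 heq
  · obtain ⟨a, ha, -⟩ := hcP.1
    obtain ⟨Q, hQ, hPQ⟩ := exists_postbar_superset
      (hB.1.subset_of_height_le hP.1 hcB.1 hcP.1 hle) ⟨a, ha⟩ hlt
    exact absurd (ball_mono hPQ hcP.1) (hcB.2 Q hQ (hP.mono (.post hB.1 hQ) hPQ))

theorem exists_mem_openPart (hB : IsBarK f k B) (hc : c ∈ ball B) :
    ∃ P, IsBarK f k P ∧ c ∈ openPart f k P := by
  induction hcard : B.card using Nat.strong_induction_on generalizing B with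
  | _ N ih =>
    by_cases hcB : c ∈ openPart f k B
    · exact ⟨B, hB, hcB⟩
    · rw [mem_openPart] at hcB
      push Not at hcB
      obtain ⟨P, hP, hPk, hcP⟩ := hcB hc
      exact ih _ (hcard ▸ card_postbar_lt hP) hPk hcP rfl

theorem existsUnique_mem_openPart (hB : IsBarK f k B) (hc : c ∈ ball B) :
    ∃! P, IsBarK f k P ∧ c ∈ openPart f k P := by
  obtain ⟨P, hP, hcP⟩ := exists_mem_openPart hB hc
  exact ⟨P, ⟨hP, hcP⟩, fun Q hQ => eq_of_mem_openPart hQ.1 hP hQ.2 hcP⟩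

end Tree

section RootCount

variable {K : Type*} [Field K] [CharZero K] {ι κ : Type*} [Fintype ι] [Fintype κ]
  {f : (PowerSeries K)[X]} {k : ℕ} {α : ι → FracSeries K} {β : κ → FracSeries K}

theorem ncard_eq_normDeriv (hα : f.map (incl K) = ∏ i, (X - C (α i)))
    (hβ : (normDeriv k f).map (incl K) = ∏ j, (X - C (β j))) {c : FracSeries K}
    (hk : k ≤ {i | α i = c}.ncard) : {j | β j = c}.ncard = {i | α i = c}.ncard - k := by
  obtain ⟨r, hr, hfk⟩ := exists_normDeriv_eq_C_mul k f
  have hr' : incl K (PowerSeries.C r) ≠ 0 :=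
    (map_ne_zero_iff _ incl_injective).2 ((map_ne_zero_iff _ PowerSeries.C_injective).2 hr)
  have hmulα : (f.map (incl K)).rootMultiplicity c = {i | α i = c}.ncard := by
    rw [hα, rootMultiplicity_prod_X_sub_C]
    simp only [Finset.mem_univ, true_and]
  have hmulβ : ((normDeriv k f).map (incl K)).rootMultiplicity c = {j | β j = c}.ncard := by
    rw [hβ, rootMultiplicity_prod_X_sub_C]
    simp only [Finset.mem_univ, true_and]
  rw [← hmulα] at hk
  rw [← hmulβ, ← hmulα, hfk, Polynomial.map_mul, map_C, rootMultiplicity_C_mul hr',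
    ← iterate_derivative_map, rootMultiplicity_iterate_derivative _ _ hk]

theorem ncard_le_contact_normDeriv (hα : f.map (incl K) = ∏ i, (X - C (α i)))
    (hβ : (normDeriv k f).map (incl K) = ∏ j, (X - C (β j))) {c : FracSeries K} {h : WithTop ℚ}
    (hk : k ≤ {i | h ≤ contact (α i) c}.ncard) :
    {j | h ≤ contact (β j) c}.ncard = {i | h ≤ contact (α i) c}.ncard - k := by
  cases h with
  | top =>
    simp only [top_le_iff, contact_eq_top] at hk ⊢
    exact ncard_eq_normDeriv hα hβ hk
  | coe h =>
    rw [← natDegree_charPoly hα] at hk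
    obtain ⟨r, hr, hfk⟩ := exists_charPoly_normDeriv_eq f c h
      (iterate_derivative_ne_zero (charPoly_ne_zero hα c h) hk)
    rw [← natDegree_charPoly hα, ← natDegree_charPoly hβ, hfk, natDegree_C_mul hr,
      natDegree_iterate_derivative_eq]

theorem rootMultiplicity_iterate_derivative_charPoly
    (hβ : (normDeriv k f).map (incl K) = ∏ j, (X - C (β j))) {b c : FracSeries K} {h : ℚ}
    (hF : derivative^[k] (charPoly f c h) ≠ 0) (hbc : (h : WithTop ℚ) ≤ contact b c) :
    (derivative^[k] (charPoly f c h)).rootMultiplicity ((b : HahnSeries ℚ K).coeff h) =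
      {j | (h : WithTop ℚ) < contact (β j) b}.ncard := by
  obtain ⟨r, hr, hfk⟩ := exists_charPoly_normDeriv_eq f c h hF
  rw [← rootMultiplicity_charPoly hβ hbc, hfk, rootMultiplicity_C_mul hr]

theorem ncard_lt_contact_normDeriv (hα : f.map (incl K) = ∏ i, (X - C (α i)))
    (hβ : (normDeriv k f).map (incl K) = ∏ j, (X - C (β j))) {c : FracSeries K} {h : WithTop ℚ}
    (hk : k ≤ {i | h < contact (α i) c}.ncard) :
    {j | h < contact (β j) c}.ncard = {i | h < contact (α i) c}.ncard - k := by
  cases h with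
  | top => simp
  | coe h =>
    have hcc : (h : WithTop ℚ) ≤ contact c c := contact_self c ▸ le_top
    have hle : {i | h < contact (α i) c}.ncard ≤ (charPoly f c h).natDegree := by
      rw [natDegree_charPoly hα]
      exact Set.ncard_le_ncard (Set.ofPred_subset_ofPred.2 fun i hi => hi.le)
    have hF := iterate_derivative_ne_zero (charPoly_ne_zero hα c h) (hk.trans hle)
    rw [← rootMultiplicity_charPoly hα hcc] at hk ⊢
    rw [← rootMultiplicity_iterate_derivative_charPoly hβ hF hcc,
      rootMultiplicity_iterate_derivative _ _ hk]

theorem isRoot_iterate_derivative_charPoly_iff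
    (hβ : (normDeriv k f).map (incl K) = ∏ j, (X - C (β j))) {b c : FracSeries K} {h : ℚ}
    (hF : derivative^[k] (charPoly f c h) ≠ 0) (hbc : (h : WithTop ℚ) ≤ contact b c) :
    (derivative^[k] (charPoly f c h)).IsRoot ((b : HahnSeries ℚ K).coeff h) ↔
      ∃ j, (h : WithTop ℚ) < contact (β j) b := by
  rw [← rootMultiplicity_pos hF, rootMultiplicity_iterate_derivative_charPoly hβ hF hbc,
    Set.ncard_pos]
  rfl

end RootCount

section Zeros

variable {K : Type*} [Field K] {ι : Type*} [Fintype ι] {f : (PowerSeries K)[X]}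
  {α : ι → FracSeries K} {B P : Finset (FracSeries K)}

theorem coe_zer (hα : f.map (incl K) = ∏ i, (X - C (α i))) :
    (zer f : Set (FracSeries K)) = Set.range α := by
  classical
  ext a
  have hne : f.map (incl K) ≠ 0 := hα ▸ (monic_prod_X_sub_C α _).ne_zero
  rw [zer, Finset.mem_coe, Multiset.mem_toFinset, mem_roots hne, hα]
  simp only [IsRoot, eval_prod, Finset.prod_eq_zero_iff, Finset.mem_univ, true_and, eval_sub,
    eval_X, eval_C, sub_eq_zero, Set.mem_range, eq_comm (a := a)]

theorem mem_zer (hα : f.map (incl K) = ∏ i, (X - C (α i))) (i : ι) : α i ∈ zer f := by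
  rw [← Finset.mem_coe, coe_zer hα]
  exact Set.mem_range_self i

theorem ncard_mem_eq_m [CharZero K] (hsq : Squarefree f)
    (hα : f.map (incl K) = ∏ i, (X - C (α i))) (hB : IsBar f B) :
    {i | α i ∈ B}.ncard = m f B := by
  rw [hB.m_eq_card, ← Set.ncard_coe_finset]
  refine Set.ncard_preimage_of_injective_subset_range (injective_of_map_incl_eq_prod hsq hα) ?_
  rw [← coe_zer hα]
  exact hB.subset_zer

theorem ncard_height_lt_contact_eq_m [CharZero K] (hsq : Squarefree f)
    (hα : f.map (incl K) = ∏ i, (X - C (α i))) (hB : IsBar f B) (hP : P ∈ postbars B)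
    {a : FracSeries K} (ha : a ∈ P) :
    {i | height B < contact (α i) a}.ncard = m f P := by
  rw [← ncard_mem_eq_m hsq hα (hB.post hP)]
  simp only [hB.mem_postbar_iff_height_lt_contact hP ha (mem_zer hα _)]

end Zeros

section DerivativeRoots

variable {K : Type*} [Field K] [CharZero K] {ι κ : Type*} [Fintype ι] [Fintype κ]
  {f : (PowerSeries K)[X]} {k : ℕ} {α : ι → FracSeries K} {β : κ → FracSeries K}
  {B : Finset (FracSeries K)}

theorem ncard_mem_ball_eq_n (hsq : Squarefree f) (hα : f.map (incl K) = ∏ i, (X - C (α i)))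
    (hβ : (normDeriv k f).map (incl K) = ∏ j, (X - C (β j))) (hB : IsBarK f k B) :
    {j | β j ∈ ball B}.ncard = n f k B := by
  obtain rfl | ⟨a, ha⟩ := B.eq_empty_or_nonempty
  · simp [n, hB.1.m_eq_card, ball]
  · have hm : {i | height B ≤ contact (α i) a}.ncard = m f B := by
      rw [← ncard_mem_eq_m hsq hα hB.1]
      simp only [hB.1.mem_iff_height_le_contact ha (mem_zer hα _)]
    simp only [mem_ball_iff ha]
    rw [ncard_le_contact_normDeriv hα hβ (hm ▸ hB.2), hm, n]

theorem ncard_mem_biUnion_ball (hsq : Squarefree f) (hα : f.map (incl K) = ∏ i, (X - C (α i)))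
    (hβ : (normDeriv k f).map (incl K) = ∏ j, (X - C (β j))) (hB : IsBar f B) :
    {j | β j ∈ ⋃ P ∈ {P | P ∈ postbars B ∧ IsBarK f k P}, ball P}.ncard =
      ∑ P ∈ postbars B, n f k P := by
  classical
  set S := {P | P ∈ postbars B ∧ IsBarK f k P}
  have hdisj : S.PairwiseDisjoint fun P => {j | β j ∈ ball P} := fun P hP Q hQ hPQ =>
    Set.disjoint_left.2 fun j hjP hjQ => hPQ (postbar_eq_of_mem_ball hP.1 hQ.1 hjP hjQ)
  have hS : S = ↑{P ∈ postbars B | IsBarK f k P} := (Finset.coe_filter _ _).symm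
  have hsum : ∑ P ∈ postbars B with IsBarK f k P, n f k P = ∑ P ∈ postbars B, n f k P :=
    Finset.sum_filter_of_ne fun P hP hn => ⟨hB.post hP, (Nat.lt_of_sub_ne_zero hn).le⟩
  rw [← hsum]
  calc {j | β j ∈ ⋃ P ∈ S, ball P}.ncard = (⋃ P ∈ S, {j | β j ∈ ball P}).ncard := by
        exact congrArg Set.ncard Set.preimage_iUnion₂
    _ = ∑ᶠ P ∈ S, {j | β j ∈ ball P}.ncard := by
        exact ((postbars B).finite_toSet.subset fun P hP => hP.1).ncard_biUnion
          (fun _ _ => Set.toFinite _) hdisj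
    _ = ∑ P ∈ postbars B with IsBarK f k P, n f k P := by
        rw [hS, finsum_mem_coe_finset]
        exact Finset.sum_congr rfl fun P hP =>
          ncard_mem_ball_eq_n hsq hα hβ (Finset.mem_filter.1 hP).2

theorem ncard_mem_openPart_eq_t (hsq : Squarefree f) (hα : f.map (incl K) = ∏ i, (X - C (α i)))
    (hβ : (normDeriv k f).map (incl K) = ∏ j, (X - C (β j))) (hB : IsBarK f k B) :
    ({j | β j ∈ openPart f k B}.ncard : ℤ) = t f k B := by
  have hsub : ⋃ P ∈ {P | P ∈ postbars B ∧ IsBarK f k P}, ball P ⊆ ball B :=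
    Set.iUnion₂_subset fun P hP => ball_mono (postbar_subset hP.1)
  have hcount := Set.ncard_sdiff_add_ncard_of_subset (Set.preimage_mono (f := β) hsub)
  rw [← Set.preimage_sdiff, eq_comm] at hcount
  rw [t, ← ncard_mem_ball_eq_n hsq hα hβ hB, ← Nat.cast_sum,
    ← ncard_mem_biUnion_ball hsq hα hβ hB.1]
  exact eq_sub_of_add_eq (by exact_mod_cast hcount.symm)

theorem m_zer (hsq : Squarefree f) (hα : f.map (incl K) = ∏ i, (X - C (α i))) :
    m f (zer f) = f.natDegree := by
  rw [natDegree_of_map_incl_eq_prod hα, ← ncard_mem_eq_m hsq hα .root,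
    ← Nat.card_eq_fintype_card, ← Set.eq_univ_iff_ncard]
  exact Set.eq_univ_of_forall (mem_zer hα)

theorem isBarK_zer [Nonempty κ] (hsq : Squarefree f)
    (hα : f.map (incl K) = ∏ i, (X - C (α i)))
    (hβ : (normDeriv k f).map (incl K) = ∏ j, (X - C (β j))) : IsBarK f k (zer f) := by
  have hcard : 0 < f.natDegree - k := by
    rw [← natDegree_normDeriv, natDegree_of_map_incl_eq_prod hβ]
    exact Fintype.card_pos
  exact ⟨.root, by rw [m_zer hsq hα]; exact (Nat.lt_of_sub_pos hcard).le⟩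

theorem mem_ball_zer (hsq : Squarefree f) (hα : f.map (incl K) = ∏ i, (X - C (α i)))
    (hβ : (normDeriv k f).map (incl K) = ∏ j, (X - C (β j))) (hk : IsBarK f k (zer f)) (j : κ) :
    β j ∈ ball (zer f) := by
  suffices {j | β j ∈ ball (zer f)} = Set.univ from this.ge (Set.mem_univ j)
  rw [Set.eq_univ_iff_ncard, ncard_mem_ball_eq_n hsq hα hβ hk, n, m_zer hsq hα,
    ← natDegree_normDeriv, natDegree_of_map_incl_eq_prod hβ, Nat.card_eq_fintype_card]

end DerivativeRoots

section Regularity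

variable {K : Type*} [Field K] [CharZero K] {ι κ : Type*} [Fintype ι] [Fintype κ]
  {f : (PowerSeries K)[X]} {k : ℕ} {α : ι → FracSeries K} {β : κ → FracSeries K}
  {B P : Finset (FracSeries K)} {h : ℚ} {a c : FracSeries K}

theorem iterate_derivative_charPoly_ne_zero (hsq : Squarefree f)
    (hα : f.map (incl K) = ∏ i, (X - C (α i))) (hB : IsBarK f k B) (hh : height B = h)
    (hc : c ∈ ball B) : derivative^[k] (charPoly f c h) ≠ 0 := by
  refine iterate_derivative_ne_zero (charPoly_ne_zero hα c h) ?_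
  rw [natDegree_charPoly hα, ← hh]
  simp only [← mem_ball_iff_of_mem_ball hc]
  refine hB.2.trans ((ncard_mem_eq_m hsq hα hB.1).symm.trans_le ?_)
  exact Set.ncard_le_ncard fun i hi => mem_ball_of_mem hi

theorem rootMultiplicity_charPoly_eq_m (hsq : Squarefree f)
    (hα : f.map (incl K) = ∏ i, (X - C (α i))) (hB : IsBar f B) (hh : height B = h)
    (hc : c ∈ ball B) (hP : P ∈ postbars B) (ha : a ∈ P) :
    (charPoly f c h).rootMultiplicity ((a : HahnSeries ℚ K).coeff h) = m f P := by
  have hac : (h : WithTop ℚ) ≤ contact a c :=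
    hh ▸ (mem_ball_iff_of_mem_ball hc).1 (mem_ball_of_mem (postbar_subset hP ha))
  rw [rootMultiplicity_charPoly hα hac, ← hh, ncard_height_lt_contact_eq_m hsq hα hB hP ha]

theorem mem_ball_postbar_iff_height_lt_contact (hsq : Squarefree f)
    (hα : f.map (incl K) = ∏ i, (X - C (α i)))
    (hβ : (normDeriv k f).map (incl K) = ∏ j, (X - C (β j))) (hB : IsBar f B)
    (hP : P ∈ postbars B) (hPk : k ≤ m f P) (ha : a ∈ P) (j : κ) :
    β j ∈ ball P ↔ height B < contact (β j) a := by
  have hsub : {j | β j ∈ ball P} ⊆ {j | height B < contact (β j) a} := fun j hj =>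
    (height_lt_height hP).trans_le ((mem_ball_iff ha).1 hj)
  have hcount : {j | height B < contact (β j) a}.ncard = {j | β j ∈ ball P}.ncard := by
    have hm := ncard_height_lt_contact_eq_m hsq hα hB hP ha
    rw [ncard_mem_ball_eq_n hsq hα hβ ⟨hB.post hP, hPk⟩, n,
      ncard_lt_contact_normDeriv hα hβ (hm ▸ hPk), hm]
  exact Set.ext_iff.1 (Set.eq_of_subset_of_ncard_le hsub hcount.le) j

theorem contact_eq_height_of_isRegular (hsq : Squarefree f)
    (hα : f.map (incl K) = ∏ i, (X - C (α i)))
    (hβ : (normDeriv k f).map (incl K) = ∏ j, (X - C (β j))) (hB : IsBarK f k B)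
    (hh : height B = h) (hc : c ∈ ball B) (hreg : IsRegular k (charPoly f c h)) {i : ι} {j : κ}
    (hi : α i ∈ ball B) (hj : β j ∈ openPart f k B) : contact (α i) (β j) = height B := by
  rw [mem_openPart] at hj
  rw [contact_comm]
  refine ((mem_ball_iff_of_mem_ball hi).1 hj.1).antisymm' (not_lt.1 fun hlt => ?_)
  have hic : (h : WithTop ℚ) ≤ contact (α i) c := hh ▸ (mem_ball_iff_of_mem_ball hc).1 hi
  have hF := iterate_derivative_charPoly_ne_zero hsq hα hB hh hc
  obtain ⟨P, hP, hiP⟩ := exists_mem_postbar (hh ▸ WithTop.coe_lt_top h)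
    (hB.1.mem_of_mem_ball (mem_zer hα i) hi)
  have hroot : (charPoly f c h).IsRoot ((α i : HahnSeries ℚ K).coeff h) :=
    (isRoot_charPoly_iff hα).2 ⟨i, hic, rfl⟩
  have hroot' : (derivative^[k] (charPoly f c h)).IsRoot ((α i : HahnSeries ℚ K).coeff h) :=
    (isRoot_iterate_derivative_charPoly_iff hβ hF hic).2 ⟨j, hh ▸ hlt⟩
  have hk : k < m f P := by
    rw [← rootMultiplicity_charPoly_eq_m hsq hα hB.1 hh hc hP hiP]
    exact not_le.1 fun hle => hreg.resolve_left hF _ hroot hle hroot'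
  exact hj.2 P hP ⟨hB.1.post hP, hk.le⟩
    ((mem_ball_postbar_iff_height_lt_contact hsq hα hβ hB.1 hP hk.le hiP j).2 hlt)

theorem exists_height_lt_contact_of_not_isRegular (hsq : Squarefree f)
    (hα : f.map (incl K) = ∏ i, (X - C (α i)))
    (hβ : (normDeriv k f).map (incl K) = ∏ j, (X - C (β j))) (hB : IsBarK f k B)
    (hh : height B = h) (hc : c ∈ ball B) (hreg : ¬ IsRegular k (charPoly f c h)) :
    ∃ i j, α i ∈ ball B ∧ β j ∈ openPart f k B ∧ height B < contact (α i) (β j) := by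
  rw [IsRegular, not_or] at hreg
  push Not at hreg
  obtain ⟨hF, z, hz, hzk, hz'⟩ := hreg
  obtain ⟨i, hic, rfl⟩ := (isRoot_charPoly_iff hα).1 hz
  obtain ⟨j, hji⟩ := (isRoot_iterate_derivative_charPoly_iff hβ hF hic).1 hz'
  rw [← hh] at hic hji
  have hij : height B < contact (α i) (β j) := contact_comm (α i) (β j) ▸ hji
  have hi : α i ∈ ball B := (mem_ball_iff_of_mem_ball hc).2 hic
  have hj : β j ∈ ball B := (mem_ball_iff_of_mem_ball hi).2 hji.le
  refine ⟨i, j, hi, mem_openPart.2 ⟨hj, fun P hP hPk hjP => ?_⟩, hij⟩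
  obtain ⟨a, ha⟩ := postbar_nonempty hP
  have hja : height B < contact (β j) a := (height_lt_height hP).trans_le ((mem_ball_iff ha).1 hjP)
  have hiP : α i ∈ P := (hB.1.mem_postbar_iff_height_lt_contact hP ha (mem_zer hα i)).2
    (lt_contact_trans hij hja)
  rw [rootMultiplicity_charPoly_eq_m hsq hα hB.1 hh hc hP hiP] at hzk
  have hcount : {j | β j ∈ ball P}.ncard = 0 := by
    rw [ncard_mem_ball_eq_n hsq hα hβ hPk, n, Nat.sub_eq_zero_of_le hzk]
  exact Set.ncard_ne_zero_of_mem (s := {j | β j ∈ ball P}) hjP (Set.toFinite _) hcount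

end Regularity

end KuoLu

theorem mainTheorem6_general {K : Type*} [Field K] [CharZero K] {ι κ : Type*} [Fintype ι]
    [Fintype κ] (f : Polynomial (PowerSeries K)) (hsq : Squarefree f) (k : ℕ)
    (α : ι → KuoLu.FracSeries K)
    (hα : f.map (KuoLu.incl K) = ∏ i, (Polynomial.X - Polynomial.C (α i)))
    (β : κ → KuoLu.FracSeries K)
    (hβ : (KuoLu.normDeriv k f).map (KuoLu.incl K) =
      ∏ j, (Polynomial.X - Polynomial.C (β j))) :
    (∀ B, KuoLu.IsBarK f k B → {j | β j ∈ KuoLu.ball B}.ncard = KuoLu.n f k B) ∧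
    (∀ B, KuoLu.IsBarK f k B →
      ({j | β j ∈ KuoLu.openPart f k B}.ncard : ℤ) = KuoLu.t f k B) ∧
    (∀ j, ∃! B, KuoLu.IsBarK f k B ∧ β j ∈ KuoLu.openPart f k B) ∧
    (∀ B, KuoLu.IsBarK f k B → ∀ h : ℚ, KuoLu.height B = (h : WithTop ℚ) →
      ∀ c ∈ KuoLu.ball B,
        (KuoLu.IsRegular k (KuoLu.charPoly f c h) →
          ∀ i j, α i ∈ KuoLu.ball B → β j ∈ KuoLu.openPart f k B →
            KuoLu.contact (α i) (β j) = KuoLu.height B) ∧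
        (¬ KuoLu.IsRegular k (KuoLu.charPoly f c h) →
          ∃ i j, α i ∈ KuoLu.ball B ∧ β j ∈ KuoLu.openPart f k B ∧
            KuoLu.height B < KuoLu.contact (α i) (β j))) := by
  refine ⟨fun B hB => KuoLu.ncard_mem_ball_eq_n hsq hα hβ hB,
    fun B hB => KuoLu.ncard_mem_openPart_eq_t hsq hα hβ hB, fun j => ?_,
    fun B hB h hh c hc =>
      ⟨fun hreg i j => KuoLu.contact_eq_height_of_isRegular hsq hα hβ hB hh hc hreg,
        KuoLu.exists_height_lt_contact_of_not_isRegular hsq hα hβ hB hh hc⟩⟩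
  have : Nonempty κ := ⟨j⟩
  have hk : KuoLu.IsBarK f k (KuoLu.zer f) := KuoLu.isBarK_zer hsq hα hβ
  exact KuoLu.existsUnique_mem_openPart hk (KuoLu.mem_ball_zer hsq hα hβ hk j)

theorem mainTheorem6 {K : Type*} [Field K] [IsAlgClosed K] [CharZero K]
    (f : Polynomial (PowerSeries K)) (hf : KuoLu.IsWeierstrass f) (hsq : Squarefree f)
    (k : ℕ) (hk : 1 ≤ k) (hkn : k ≤ f.natDegree)
    (α : Fin f.natDegree → KuoLu.FracSeries K)
    (hα : f.map (KuoLu.incl K) = ∏ i, (Polynomial.X - Polynomial.C (α i)))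
    (β : Fin (f.natDegree - k) → KuoLu.FracSeries K)
    (hβ : (KuoLu.normDeriv k f).map (KuoLu.incl K) =
      ∏ j, (Polynomial.X - Polynomial.C (β j))) :
    -- (i)
    (∀ B, KuoLu.IsBarK f k B → {j | β j ∈ KuoLu.ball B}.ncard = KuoLu.n f k B) ∧
    -- (ii)
    (∀ B, KuoLu.IsBarK f k B →
      ({j | β j ∈ KuoLu.openPart f k B}.ncard : ℤ) = KuoLu.t f k B) ∧
    -- (iii)
    (∀ j, ∃! B, KuoLu.IsBarK f k B ∧ β j ∈ KuoLu.openPart f k B) ∧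
    -- (iv), for the bars of finite height; `c` is any element of the pseudo-ball
    (∀ B, KuoLu.IsBarK f k B → ∀ h : ℚ, KuoLu.height B = (h : WithTop ℚ) →
      ∀ c ∈ KuoLu.ball B,
        (KuoLu.IsRegular k (KuoLu.charPoly f c h) →
          ∀ i j, α i ∈ KuoLu.ball B → β j ∈ KuoLu.openPart f k B →
            KuoLu.contact (α i) (β j) = KuoLu.height B) ∧
        (¬ KuoLu.IsRegular k (KuoLu.charPoly f c h) →
          ∃ i j, α i ∈ KuoLu.ball B ∧ β j ∈ KuoLu.openPart f k B ∧
            KuoLu.height B < KuoLu.contact (α i) (β j))) :=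
  mainTheorem6_general f hsq k α hα β hβ
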